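/- A bichain is a structure $B=(V,(\leq_1,\leq_2))$ consisting of a set $V$ with two total orders; its transpose is $B^t=(V,(\leq_2,\leq_1))$, and $o(B)$ is the poset $(V,\leq_1\cap\leq_2)$. A bichain embeds in another if it is isomorphic to a bichain induced on a subset of the latter. The age of a bichain $R$ is the class of finite bichains that embed in $R$. A module of $B$ is a set $A\subseteq V$ such that, for $i=1,2$, all $a,a'\in A$ and all $v\in V\setminus A$: $v\leq_i a$ implies $v\leq_i a'$, and $a\leq_i v$ implies $a'\leq_i v$. The bichain $B$ is prime if its only modules are $\emptyset$, the singletons and $V$. A class of bichains is hereditary if it contains every bichain that embeds into one of its members. A hereditary class of finite bichains is minimal prime if it contains, up to isomorphism, infinitely many prime bichains, while each of its proper hereditary subclasses contains only finitely many. Let $B_1=(\mathbb N,(\leq,\leq_{\omega+\omega}))$ and $B_2=(\mathbb N,(\leq,\leq_\omega))$, where $\leq$ is the natural order, $\leq_{\omega+\omega}$ puts the odd integers in their natural order before all even integers in their natural order, and $i\leq_\omega j$ if and only if $\sigma(i)\leq\sigma(j)$, where $\sigma$ is the permutation of $\mathbb N$ given by $\sigma(0)=1$, $\sigma(1)=3$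 and, for $n\geq 1$, $\sigma(2n)=2n-2$, $\sigma(2n+1)=2n+3$. Theorem. Let $\mathcal C$ be a minimal prime class of finite bichains such that, for every $B\in\mathcal C$, the poset $o(B)$ has width at most two (every antichain of $o(B)$ has at most two elements). Then $\mathcal C$ is the age of one of the bichains $B_1$, $B_1^t$ or $B_2$. -/

import Mathlib

universe u v w

/-- A bichain: a set equipped with two (reflexive) total orders. -/
structure Bichain : Type (u + 1) where
  /-- The underlying set. -/
  carrier : Type u
  /-- The first order. -/
  le₁ : carrier → carrier → Prop
  /-- The second order. -/
  le₂ : carrier → carrier → Prop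
  linear₁ : IsLinearOrder carrier le₁
  linear₂ : IsLinearOrder carrier le₂

namespace Bichain

/-- The transpose of a bichain: its two orders are exchanged. -/
def transpose (B : Bichain.{u}) : Bichain.{u} where
  carrier := B.carrier
  le₁ := B.le₂
  le₂ := B.le₁
  linear₁ := B.linear₂
  linear₂ := B.linear₁

/-- The poset `o(B)`: the order is the intersection of the two orders of `B`. -/
abbrev interOrder (B : Bichain.{u}) : PartialOrder B.carrier where
  le x y := B.le₁ x y ∧ B.le₂ x y
  le_refl x := ⟨B.linear₁.refl x, B.linear₂.refl x⟩
  le_trans x y z h h' :=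
    ⟨B.linear₁.trans x y z h.1 h'.1, B.linear₂.trans x y z h.2 h'.2⟩
  le_antisymm x y h h' := B.linear₁.antisymm x y h.1 h'.1

/-- `A` embeds in `B`: `A` is isomorphic to a bichain induced by `B` on a subset. -/
def Embeds (A : Bichain.{u}) (B : Bichain.{v}) : Prop :=
  ∃ f : A.carrier → B.carrier, Function.Injective f ∧
    (∀ x y, B.le₁ (f x) (f y) ↔ A.le₁ x y) ∧
    (∀ x y, B.le₂ (f x) (f y) ↔ A.le₂ x y)

/-- `A` and `B` are isomorphic. -/
def Iso (A : Bichain.{u}) (B : Bichain.{v}) : Prop :=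
  ∃ e : A.carrier ≃ B.carrier,
    (∀ x y, B.le₁ (e x) (e y) ↔ A.le₁ x y) ∧
    (∀ x y, B.le₂ (e x) (e y) ↔ A.le₂ x y)

theorem Iso.rfl' (A : Bichain.{u}) : A.Iso A :=
  ⟨Equiv.refl _, fun _ _ => Iff.rfl, fun _ _ => Iff.rfl⟩

theorem Iso.symm' {A : Bichain.{u}} {B : Bichain.{v}} (h : A.Iso B) : B.Iso A := by
  obtain ⟨e, h₁, h₂⟩ := h
  exact ⟨e.symm, fun x y => by rw [← h₁]; simp, fun x y => by rw [← h₂]; simp⟩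

theorem Iso.trans' {A : Bichain.{u}} {B : Bichain.{v}} {C : Bichain.{w}}
    (h : A.Iso B) (h' : B.Iso C) : A.Iso C := by
  obtain ⟨e, h₁, h₂⟩ := h
  obtain ⟨e', h₁', h₂'⟩ := h'
  exact ⟨e.trans e', fun x y => (h₁' _ _).trans (h₁ x y),
    fun x y => (h₂' _ _).trans (h₂ x y)⟩

/-- Isomorphy of bichains, as an equivalence relation. -/
def isoSetoid : Setoid Bichain.{u} where
  r A B := A.Iso B
  iseqv := ⟨Iso.rfl', Iso.symm', Iso.trans'⟩

/-- `M` is a module of the bichain `B`: elements of `M` are not distinguished, by either of the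
two orders, by an element outside `M`. -/
def IsModule (B : Bichain.{u}) (M : Set B.carrier) : Prop :=
  ∀ a ∈ M, ∀ a' ∈ M, ∀ x, x ∉ M →
    ((B.le₁ x a → B.le₁ x a') ∧ (B.le₁ a x → B.le₁ a' x)) ∧
    ((B.le₂ x a → B.le₂ x a') ∧ (B.le₂ a x → B.le₂ a' x))

/-- `B` is prime: its only modules are the empty set, the singletons and the whole set. -/
def IsPrime (B : Bichain.{u}) : Prop :=
  ∀ M : Set B.carrier, B.IsModule M → M = ∅ ∨ (∃ a, M = {a}) ∨ M = Set.univ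

/-- The age of `R`: the class of finite bichains that embed in `R`. -/
def age (R : Bichain.{v}) : Set Bichain.{u} :=
  {A | Finite A.carrier ∧ A.Embeds R}

/-- A class of bichains is hereditary if it contains every bichain that embeds into a member. -/
def IsHereditary (C : Set Bichain.{u}) : Prop :=
  ∀ B ∈ C, ∀ A : Bichain.{u}, A.Embeds B → A ∈ C

/-- The set of isomorphism types of prime members of a class of bichains. -/
def primeTypes (C : Set Bichain.{u}) : Set (Quotient isoSetoid.{u}) :=
  {q | ∃ B ∈ C, B.IsPrime ∧ Quotient.mk isoSetoid B = q}

/-- A minimal prime class of finite bichains: a hereditary class of finite bichains that contains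
infinitely many prime bichains (up to isomorphy), while each of its proper hereditary subclasses
contains only finitely many. -/
structure IsMinimalPrime (C : Set Bichain.{u}) : Prop where
  finite : ∀ B ∈ C, Finite B.carrier
  hereditary : IsHereditary C
  infinite_primes : (primeTypes C).Infinite
  minimal : ∀ D : Set Bichain.{u}, IsHereditary D → D ⊂ C → (primeTypes D).Finite

/-- The order `≤_{ω+ω}` on `ℕ`: the odd integers in their natural order come before the even
integers in their natural order. -/
def leOmegaOmega (i j : ℕ) : Prop :=
  (Odd i ∧ Even j) ∨ ((Odd i ↔ Odd j) ∧ i ≤ j)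

/-- The permutation `σ` of `ℕ`, with `σ 0 = 1`, `σ 1 = 3`, and `σ (2 n) = 2 n - 2`,
`σ (2 n + 1) = 2 n + 3` for `n ≥ 1`. -/
def sigma : ℕ → ℕ
  | 0 => 1
  | 1 => 3
  | i + 2 => if Even i then i else i + 4

theorem sigma_bijective : Function.Bijective sigma := by
  constructor
  · rintro (_ | _ | i) (_ | _ | j) h <;> simp only [sigma] at h <;> grind
  · intro k
    rcases Nat.even_or_odd k with hk | hk
    · exact ⟨k + 2, by simp [sigma, hk]⟩
    · obtain ⟨m, rfl⟩ := hk
      match m with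
      | 0 => exact ⟨0, rfl⟩
      | 1 => exact ⟨1, rfl⟩
      | n + 2 => exact ⟨2 * n + 1 + 2, by simp only [sigma]; grind⟩

/-- The order `≤_ω` on `ℕ`, isomorphic to `ω` through `σ`. -/
def leOmega (i j : ℕ) : Prop := sigma i ≤ sigma j

theorem isLinearOrder_natLe : IsLinearOrder ℕ (fun i j : ℕ => i ≤ j) where
  refl := le_refl
  trans _ _ _ := le_trans
  antisymm _ _ := le_antisymm
  total := le_total

theorem isLinearOrder_leOmegaOmega : IsLinearOrder ℕ leOmegaOmega where
  refl i := by unfold leOmegaOmega; grind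
  trans i j k := by unfold leOmegaOmega; grind
  antisymm i j := by unfold leOmegaOmega; grind
  total i j := by unfold leOmegaOmega; grind

theorem isLinearOrder_leOmega : IsLinearOrder ℕ leOmega where
  refl _ := le_refl _
  trans _ _ _ h h' := le_trans (α := ℕ) h h'
  antisymm _ _ h h' := sigma_bijective.1 (le_antisymm h h')
  total _ _ := le_total _ _

/-- The bichain `B₁ = (ℕ, (≤, ≤_{ω+ω}))`. -/
def B₁ : Bichain.{0} where
  carrier := ℕ
  le₁ i j := i ≤ j
  le₂ := leOmegaOmega
  linear₁ := isLinearOrder_natLe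
  linear₂ := isLinearOrder_leOmegaOmega

/-- The bichain `B₂ = (ℕ, (≤, ≤_ω))`. -/
def B₂ : Bichain.{0} where
  carrier := ℕ
  le₁ i j := i ≤ j
  le₂ := leOmega
  linear₁ := isLinearOrder_natLe
  linear₂ := isLinearOrder_leOmega

end Bichain

/-- A poset has width at most two if none of its antichains has more than two elements. -/
def WidthAtMostTwo {V : Type u} (P : PartialOrder V) : Prop :=
  ∀ s : Set V, IsAntichain P.le s → s.encard ≤ 2

/-! Code a finite bichain of width at most two by injective ranks `f`, `g`. An inversion is a pair
ordered oppositely by `f` and `g`; call its `f`-earlier end upper and its `f`-later end lower. Width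
two means that no element is both. In a prime bichain with at least three elements every element is
one or the other (`cover`), and two upper elements are always separated by a lower one in one of the
orders (`separate`). On the upper elements both orders agree, and likewise on the lower ones. So the
bichain is two chains, and only their interleavings matter.

A large prime bichain has a long chain of upper elements (`card_lt_of_upper_lt`). Cut it into
windows. If no lower element lies `g`-after the start and `f`-before the end of some window, the
separators inside that window give, by pigeonhole, a segment of `B₁` or of its transpose
(`segment_of_window`). Otherwise every window has such a lower element. A zigzag of extremal
inversions then advances by at most one window per step (`step`, `segment_of_separated`), and it is
a segment of `B₂` (`segment_of_path`).

A minimal prime class has arbitrarily large primes, so it contains all segments of one of the three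
bichains, hence its age by heredity. That age itself has infinitely many primes (`segment_isPrime`
and the `closed_eq_all` lemmas), so minimality gives equality. -/

open Function in
/-- Two injective rank functions coding a prime bichain whose intersection order has no
three-element antichain. -/
structure PrimePair {V : Type u} (f g : V → ℕ) : Prop where
  inj_fst : Injective f
  inj_snd : Injective g
  no_antichain : ∀ x y z, f x < f y → f y < f z → g y < g x → g z < g y → False
  prime : ∀ M : Set V, (∀ a ∈ M, ∀ a' ∈ M, ∀ x ∉ M,
    (f x < f a → f x < f a') ∧ (g x < g a → g x < g a')) → M.Subsingleton ∨ M = Set.univ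

/-- The elements that are the upper left end of an inversion. -/
def invTops {V : Type u} (f g : V → ℕ) : Set V := {x | ∃ y, f x < f y ∧ g y < g x}

/-! ### Upper and lower elements of a prime pair -/

namespace PrimePair

variable {V : Type u} {f g : V → ℕ}

theorem swap (h : PrimePair f g) : PrimePair g f where
  inj_fst := h.inj_snd
  inj_snd := h.inj_fst
  no_antichain x y z h₁ h₂ h₃ h₄ := h.no_antichain z y x h₄ h₃ h₂ h₁
  prime M hM := h.prime M fun a ha a' ha' x hx => (hM a ha a' ha' x hx).symm

theorem disjoint (h : PrimePair f g) {x : V} (hx : x ∈ invTops f g)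
    (hx' : x ∈ invTops g f) : False := by
  obtain ⟨y, h₁, h₂⟩ := hx
  obtain ⟨z, h₃, h₄⟩ := hx'
  exact h.no_antichain z x y h₄ h₁ h₃ h₂

theorem ne_snd (h : PrimePair f g) {x y : V} (hxy : f x < f y) : g x ≠ g y := fun e => by
  rw [h.inj_snd e] at hxy; exact lt_irrefl _ hxy

/-- Otherwise `x` and `y` would form an inversion with `y` as its lower end. In particular the two
orders agree on upper elements. -/
theorem snd_lt (h : PrimePair f g) {x y : V} (hy : y ∈ invTops f g) (hxy : f x < f y) :
    g x < g y := by
  by_contra hc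
  have := h.ne_snd hxy
  exact h.disjoint hy ⟨x, by omega, hxy⟩

theorem snd_lt_of_lower (h : PrimePair f g) {x y : V} (hx : x ∈ invTops g f)
    (hxy : f x < f y) : g x < g y := by
  by_contra hc
  have := h.ne_snd hxy
  have := h.swap.snd_lt hx (x := y) (by omega)
  omega

theorem initial (h : PrimePair f g) {S : Set V}
    (hS : ∀ a ∈ S, ∀ x ∉ S, f a < f x ∧ g a < g x) : S.Subsingleton ∨ S = Set.univ :=
  h.prime S fun a ha a' _ x hx => by
    have := hS a ha x hx
    exact ⟨fun _ => by omega, fun _ => by omega⟩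

theorem final (h : PrimePair f g) {S : Set V}
    (hS : ∀ a ∈ S, ∀ x ∉ S, f x < f a ∧ g x < g a) : S.Subsingleton ∨ S = Set.univ :=
  h.prime S fun a _ a' ha' x hx => by
    have := hS a' ha' x hx
    exact ⟨fun _ => by omega, fun _ => by omega⟩

/-- An element in no inversion cuts the bichain into the elements below it and those above it in
both orders. Both parts, and the lower part together with `x`, are modules; a third element makes
one of them nontrivial. -/
theorem cover [Finite V] (h : PrimePair f g) (hV : 3 ≤ Nat.card V) (x : V) :
    x ∈ invTops f g ∨ x ∈ invTops g f := by
  by_contra hc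
  obtain ⟨h₁, h₂⟩ := not_or.1 hc
  have key : ∀ y, f x < f y ↔ g x < g y := by
    intro y
    have hne : f x = f y → g x = g y := fun e => by rw [h.inj_fst e]
    have hne' : g x = g y → f x = f y := fun e => by rw [h.inj_snd e]
    have a : ¬ (f x < f y ∧ g y < g x) := fun q => h₁ ⟨y, q⟩
    have b : ¬ (g x < g y ∧ f y < f x) := fun q => h₂ ⟨y, q⟩
    omega
  have hneq : ∀ y, f x = f y → g x = g y := fun y e => by rw [h.inj_fst e]
  have hneq' : ∀ y, g x = g y → f x = f y := fun y e => by rw [h.inj_snd e]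
  have s₁ := h.initial (S := {y | f y ≤ f x}) (fun a ha z hz => by
    have := key a; have := key z; have := hneq a; have := hneq' a
    simp only [Set.mem_ofPred_eq] at ha hz
    omega)
  have s₃ := h.initial (S := {y | f y < f x}) (fun a ha z hz => by
    have := hneq z; have := key a; have := key z; have := hneq a; have := hneq' a
    simp only [Set.mem_ofPred_eq] at ha hz
    omega)
  have s₄ := h.final (S := {y | f x < f y}) (fun a ha z hz => by
    have := key a; have := key z; have := hneq a; have := hneq' z; have := hneq z
    simp only [Set.mem_ofPred_eq] at ha hz
    omega)
  have s₃' : Set.Subsingleton {y | f y < f x} :=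
    s₃.resolve_right fun e => by
      have : x ∈ {y | f y < f x} := by rw [e]; trivial
      simp at this
  have s₄' : Set.Subsingleton {y | f x < f y} :=
    s₄.resolve_right fun e => by
      have : x ∈ {y | f x < f y} := by rw [e]; trivial
      simp at this
  have := Fintype.ofFinite V
  rw [Nat.card_eq_fintype_card, ← Finset.card_univ] at hV
  obtain ⟨a, b, hb⟩ : ∃ a b, a ≠ b ∧ a ≠ x ∧ b ≠ x := by
    obtain ⟨a, b, c, _, _, _, hab, hac, hbc⟩ := Finset.two_lt_card_iff.1 hV
    by_cases h1 : a = x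
    · exact ⟨b, c, by grind⟩
    · by_cases h2 : b = x
      · exact ⟨a, c, by grind⟩
      · exact ⟨a, b, by grind⟩
  have hax : f a ≠ f x := fun e => hb.2.1 (h.inj_fst e)
  have hbx : f b ≠ f x := fun e => hb.2.2 (h.inj_fst e)
  have main : ∀ a b : V, f a < f x → f x < f b → False := by
    intro a b ha hb
    rcases s₁ with s₁ | s₁
    · have := s₁ (show f a ≤ f x by omega) (show f x ≤ f x from le_rfl)
      subst this; omega
    · have : b ∈ {y | f y ≤ f x} := by rw [s₁]; trivial
      simp only [Set.mem_ofPred_eq] at this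
      omega
  rcases lt_or_gt_of_ne hax with ha | ha <;> rcases lt_or_gt_of_ne hbx with hb' | hb'
  · exact hb.1 (s₃' ha hb')
  · exact main a b ha hb'
  · exact main b a hb' ha
  · exact hb.1 (s₄' ha hb')

/-- Without such an `l`, the interval from `x` to `y` in the chain of upper elements is a module. It
has two elements and misses the lower partner of `x`. -/
theorem separate (h : PrimePair f g) (hc : ∀ x, x ∈ invTops f g ∨ x ∈ invTops g f) {x y : V}
    (hx : x ∈ invTops f g) (hy : y ∈ invTops f g) (hxy : f x < f y) :
    ∃ l ∈ invTops g f, (f x < f l ∧ f l < f y) ∨ (g x < g l ∧ g l < g y) := by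
  by_contra! hl
  have hfl : ∀ a ∈ invTops f g, ∀ l ∈ invTops g f, f a ≠ f l ∧ g a ≠ g l := by
    intro a ha l hl
    exact ⟨fun e => h.disjoint ha (h.inj_fst e ▸ hl), fun e => h.disjoint ha (h.inj_snd e ▸ hl)⟩
  have hg : ∀ a ∈ invTops f g, ∀ b ∈ invTops f g, f a < f b ↔ g a < g b := by
    intro a ha b hb
    refine ⟨h.snd_lt hb, fun e => ?_⟩
    by_contra hn
    have := h.swap.ne_snd e
    have := h.snd_lt ha (x := b) (by omega)
    omega
  rcases h.prime {z | z ∈ invTops f g ∧ f x ≤ f z ∧ f z ≤ f y} (by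
    rintro a ⟨ha, ha₁, ha₂⟩ b ⟨hb, hb₁, hb₂⟩ z hz
    have ga := hg x hx a ha
    have ga' := hg a ha y hy
    have gb := hg x hx b hb
    have gb' := hg b hb y hy
    have ea : f a = f x → g a = g x := fun e => by rw [h.inj_fst e]
    have eb : f b = f x → g b = g x := fun e => by rw [h.inj_fst e]
    have ea' : f a = f y → g a = g y := fun e => by rw [h.inj_fst e]
    have eb' : f b = f y → g b = g y := fun e => by rw [h.inj_fst e]
    rcases hc z with hz' | hz'
    · have : ¬ (f x ≤ f z ∧ f z ≤ f y) := fun q => hz ⟨hz', q⟩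
      have := hg x hx z hz'
      have := hg z hz' y hy
      have := hg z hz' a ha
      have := hg z hz' b hb
      omega
    · have := hl z hz'
      have := hfl x hx z hz'
      have := hfl y hy z hz'
      have := hfl a ha z hz'
      have := hfl b hb z hz'
      omega) with s | s
  · have := s ⟨hx, le_rfl, hxy.le⟩ ⟨hy, hxy.le, le_rfl⟩
    subst this; omega
  · obtain ⟨l, hl₁, hl₂⟩ := hx
    have : l ∈ {z | z ∈ invTops f g ∧ f x ≤ f z ∧ f z ≤ f y} := by rw [s]; trivial
    exact h.disjoint this.1 ⟨x, hl₂, hl₁⟩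

end PrimePair

/-! ### Segments of `B₁` and its transpose from alternating chains -/

/-- The restriction of `(ℕ, r, s)` to `{0, …, n - 1}` embeds in the bichain coded by `f, g`. -/
def SegmentEmbeds {V : Type u} (r s : ℕ → ℕ → Prop) (n : ℕ) (f g : V → ℕ) : Prop :=
  ∃ h : ℕ → V, ∀ i < n, ∀ j < n, i ≠ j →
    (r i j → f (h i) < f (h j)) ∧ (s i j → g (h i) < g (h j))

theorem exists_increasing_of_le_card {α : Type u} [Nonempty α] {f : α → ℕ}
    (hf : Function.Injective f) (S : Finset α) {k : ℕ} (hk : k ≤ S.card) :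
    ∃ e : ℕ → α, (∀ i < k, e i ∈ S) ∧ ∀ i j, i < j → j < k → f (e i) < f (e j) := by
  classical
  have hc : k ≤ (S.image f).card := by rwa [Finset.card_image_of_injective _ hf]
  let o := (S.image f).orderEmbOfCardLe hc
  have ho : ∀ i : Fin k, ∃ x ∈ S, f x = o i := fun i => by
    simpa using (S.image f).orderEmbOfCardLe_mem hc i
  choose x hx hfx using ho
  refine ⟨fun i => if hi : i < k then x ⟨i, hi⟩ else Classical.arbitrary α, fun i hi => ?_,
    fun i j hij hj => ?_⟩
  · simp [hi, hx]
  · have hi : i < k := hij.trans hj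
    simp only [hi, hj, dif_pos, hfx]
    exact o.strictMono hij

namespace PrimePair

variable {V : Type u} {f g : V → ℕ}

/-- Upper elements separated in the first order by lower elements, all of which are below all
of them in the second order, form a segment of `B₁`. -/
theorem segment_of_alternation (h : PrimePair f g) {k : ℕ} {x l : ℕ → V}
    (hx : ∀ i < k, x i ∈ invTops f g) (hl : ∀ i < k, l i ∈ invTops g f)
    (h₁ : ∀ i < k, f (x i) < f (l i)) (h₂ : ∀ i j, i < j → j < k → f (l i) < f (x j))
    (h₃ : ∀ i < k, ∀ j < k, g (l i) < g (x j)) :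
    SegmentEmbeds (· ≤ ·) Bichain.leOmegaOmega (2 * k) f g := by
  have hxx : ∀ i j, i < j → j < k → f (x i) < f (x j) := fun i j hij hj =>
    (h₁ i (hij.trans hj)).trans (h₂ i j hij hj)
  have hll : ∀ i j, i < j → j < k → f (l i) < f (l j) := fun i j hij hj =>
    (h₂ i j hij hj).trans (h₁ j hj)
  have gx : ∀ i j, i < j → j < k → g (x i) < g (x j) := fun i j hij hj =>
    h.snd_lt (hx j hj) (hxx i j hij hj)
  have gl : ∀ i j, i < j → j < k → g (l i) < g (l j) := fun i j hij hj =>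
    h.snd_lt_of_lower (hl i (hij.trans hj)) (hll i j hij hj)
  refine ⟨fun i => if Even i then x (i / 2) else l (i / 2), fun i hi j hj hij => ?_⟩
  have hi' : i / 2 < k := by omega
  have hj' : j / 2 < k := by omega
  rcases Nat.even_or_odd' i with ⟨a, rfl | rfl⟩ <;> rcases Nat.even_or_odd' j with ⟨b, rfl | rfl⟩
  · have e₁ : 2 * a / 2 = a := by omega
    have e₂ : 2 * b / 2 = b := by omega
    simp only [e₁, e₂, even_two_mul, if_true, Bichain.leOmegaOmega] at hi' hj' ⊢
    refine ⟨fun q => hxx a b (by omega) hj', fun q => gx a b (by grind) hj'⟩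
  · have e₁ : 2 * a / 2 = a := by omega
    have e₂ : (2 * b + 1) / 2 = b := by omega
    have e₃ : ¬ Even (2 * b + 1) := by grind
    simp only [e₁, e₂, e₃, even_two_mul, if_true, if_false, Bichain.leOmegaOmega] at hi' hj' ⊢
    refine ⟨fun q => ?_, fun q => by grind⟩
    rcases eq_or_lt_of_le (show a ≤ b by omega) with e | e
    · subst e; exact h₁ _ hi'
    · exact (hxx a b e hj').trans (h₁ b hj')
  · have e₁ : (2 * a + 1) / 2 = a := by omega
    have e₂ : 2 * b / 2 = b := by omega
    have e₃ : ¬ Even (2 * a + 1) := by grind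
    simp only [e₁, e₂, e₃, even_two_mul, if_true, if_false, Bichain.leOmegaOmega] at hi' hj' ⊢
    exact ⟨fun q => h₂ a b (by omega) hj', fun q => h₃ a hi' b hj'⟩
  · have e₁ : (2 * a + 1) / 2 = a := by omega
    have e₂ : (2 * b + 1) / 2 = b := by omega
    have e₃ : ¬ Even (2 * a + 1) := by grind
    have e₄ : ¬ Even (2 * b + 1) := by grind
    simp only [e₁, e₂, e₃, e₄, if_false, Bichain.leOmegaOmega] at hi' hj' ⊢
    refine ⟨fun q => hll a b (by omega) hj', fun q => gl a b (by grind) hj'⟩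

theorem segment_of_alternation_swap (h : PrimePair f g) {k : ℕ} {x l : ℕ → V}
    (hx : ∀ i < k, x i ∈ invTops f g) (hl : ∀ i < k, l i ∈ invTops g f)
    (h₁ : ∀ i < k, g (l i) < g (x i)) (h₂ : ∀ i j, i < j → j < k → g (x i) < g (l j))
    (h₃ : ∀ i < k, ∀ j < k, f (x i) < f (l j)) :
    SegmentEmbeds Bichain.leOmegaOmega (· ≤ ·) (2 * k) f g := by
  obtain ⟨e, he⟩ := h.swap.segment_of_alternation hl hx h₁ h₂ h₃
  exact ⟨e, fun i hi j hj hij => (he i hi j hj hij).symm⟩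

/-- A long chain of upper elements without a lower element between its ends. -/
theorem segment_of_window (h : PrimePair f g) (hc : ∀ x, x ∈ invTops f g ∨ x ∈ invTops g f)
    {k : ℕ} {x : ℕ → V} (hx : ∀ i ≤ 2 * k, x i ∈ invTops f g)
    (hf : ∀ i j, i < j → j ≤ 2 * k → f (x i) < f (x j))
    (hlink : ∀ l ∈ invTops g f, ¬ (g (x 0) < g l ∧ f l < f (x (2 * k)))) :
    SegmentEmbeds (· ≤ ·) Bichain.leOmegaOmega (2 * k) f g ∨
      SegmentEmbeds Bichain.leOmegaOmega (· ≤ ·) (2 * k) f g := by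
  classical
  have hsep : ∀ i, ∃ l, i < 2 * k → l ∈ invTops g f ∧
      ((f (x i) < f l ∧ f l < f (x (i + 1))) ∨ (g (x i) < g l ∧ g l < g (x (i + 1)))) := by
    intro i
    by_cases hi : i < 2 * k
    · obtain ⟨l, hl⟩ := h.separate hc (hx i hi.le) (hx (i + 1) hi) (hf i (i + 1) (by omega) hi)
      exact ⟨l, fun _ => hl⟩
    · exact ⟨x 0, fun q => absurd q hi⟩
  choose l hl using hsep
  have hf' : ∀ i j, i ≤ j → j ≤ 2 * k → f (x i) ≤ f (x j) := fun i j hij hj => by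
    rcases eq_or_lt_of_le hij with rfl | e
    · exact le_rfl
    · exact (hf i j e hj).le
  have hg' : ∀ i j, i ≤ j → j ≤ 2 * k → g (x i) ≤ g (x j) := fun i j hij hj => by
    rcases eq_or_lt_of_le hij with rfl | e
    · exact le_rfl
    · exact (h.snd_lt (hx j hj) (hf i j e hj)).le
  have hne : ∀ i < 2 * k, ∀ j ≤ 2 * k, f (x j) ≠ f (l i) ∧ g (x j) ≠ g (l i) := by
    intro i hi j hj
    exact ⟨fun e => h.disjoint (hx j hj) (h.inj_fst e ▸ (hl i hi).1),
      fun e => h.disjoint (hx j hj) (h.inj_snd e ▸ (hl i hi).1)⟩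
  let A := (Finset.range (2 * k)).filter fun i => f (x i) < f (l i) ∧ f (l i) < f (x (i + 1))
  let B := (Finset.range (2 * k)).filter fun i => g (x i) < g (l i) ∧ g (l i) < g (x (i + 1))
  -- Each of the `2 * k` gaps is separated in the first order or in the second, so one kind occurs
  -- at least `k` times.
  have hAB : 2 * k ≤ A.card + B.card := by
    calc 2 * k = (Finset.range (2 * k)).card := by simp
      _ ≤ (A ∪ B).card := Finset.card_le_card fun i hi => by
          have := (hl i (by simpa using hi)).2
          simp only [A, B, Finset.mem_union, Finset.mem_filter]
          tauto
      _ ≤ _ := Finset.card_union_le _ _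
  rcases (by omega : k ≤ A.card ∨ k ≤ B.card) with hA | hB
  · obtain ⟨e, he, hmono⟩ := exists_increasing_of_le_card (f := id) Function.injective_id A hA
    simp only [A, Finset.mem_filter, Finset.mem_range, id] at he hmono
    refine .inl (h.segment_of_alternation (x := x ∘ e) (l := l ∘ e)
      (fun i hi => hx _ (he i hi).1.le) (fun i hi => (hl _ (he i hi).1).1)
      (fun i hi => (he i hi).2.1) (fun i j hij hj => ?_) (fun i hi j hj => ?_))
    · have := (he i (hij.trans hj)).2.2
      have := hf' (e i + 1) (e j) (hmono i j hij hj) (he j hj).1.le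
      simp only [Function.comp]; omega
    -- This separator is `f`-before the end of the window, so `hlink` puts it `g`-before the start,
    -- hence `g`-before every chosen upper element.
    · have h₁ := (he i hi).2.2
      have h₂ := hf' (e i + 1) (2 * k) (he i hi).1 le_rfl
      have h₃ := hlink _ (hl _ (he i hi).1).1
      have h₄ := hg' 0 (e j) (by omega) (he j hj).1.le
      have h₅ := (hne _ (he i hi).1 0 (by omega)).2
      simp only [Function.comp]; omega
  · obtain ⟨e, he, hmono⟩ := exists_increasing_of_le_card (f := id) Function.injective_id B hB
    simp only [B, Finset.mem_filter, Finset.mem_range, id] at he hmono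
    -- In the transposed pattern each lower element precedes its upper one, so the right end of each
    -- gap is taken.
    refine .inr (h.segment_of_alternation_swap (x := fun i => x (e i + 1)) (l := l ∘ e)
      (fun i hi => hx _ (he i hi).1) (fun i hi => (hl _ (he i hi).1).1)
      (fun i hi => (he i hi).2.2) (fun i j hij hj => ?_) (fun i hi j hj => ?_))
    · have := (he j hj).2.1
      have := hg' (e i + 1) (e j) (hmono i j hij hj) (he j hj).1.le
      simp only [Function.comp]; omega
    · have h₁ := (he j hj).2.1
      have h₂ := hg' 0 (e j) (by omega) (he j hj).1.le
      have h₃ := hlink _ (hl _ (he j hj).1).1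
      have h₄ := hf' (e i + 1) (2 * k) (he i hi).1 le_rfl
      have h₅ := (hne _ (he j hj).1 (2 * k) le_rfl).1
      simp only [Function.comp]; omega

/-! ### The zigzag of extremal inversions and segments of `B₂` -/

theorem exists_max_lower [Finite V] {x : V} (hx : x ∈ invTops f g) :
    ∃ l, (f x < f l ∧ g l < g x) ∧ ∀ y, f x < f y ∧ g y < g x → g y ≤ g l := by
  obtain ⟨l, hl, hm⟩ := Set.exists_max_image {y | f x < f y ∧ g y < g x} g (Set.toFinite _) hx
  exact ⟨l, hl, hm⟩

/-- One step of the oscillation starting at `x`, which stays before `z` if some lower element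
is between `x` and `z`. -/
theorem step [Finite V] (h : PrimePair f g) (hc : ∀ x, x ∈ invTops f g ∨ x ∈ invTops g f)
    {x y l₀ : V} (hx : x ∈ invTops f g) (hy : y ∈ invTops f g) (hl₀ : l₀ ∈ invTops g f)
    (h₁ : g x < g l₀) (h₂ : f l₀ < f y) :
    ∃ l x', x' ∈ invTops f g ∧ (f x < f l ∧ g l < g x) ∧ (f x' < f l ∧ g l < g x') ∧
      (∀ m, f x < f m ∧ g m < g x → g m ≤ g l) ∧ (∀ z, f z < f l ∧ g l < g z → f z ≤ f x') ∧
      f x < f x' ∧ f x' < f y := by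
  obtain ⟨l, hl, hlm⟩ := exists_max_lower hx
  have hlL : l ∈ invTops g f := ⟨x, hl.2, hl.1⟩
  obtain ⟨x', hx', hxm⟩ := exists_max_lower hlL
  simp only [and_comm] at hx' hxm
  have hxU : x' ∈ invTops f g := ⟨l, hx'⟩
  have hll : f l < f l₀ := h.swap.snd_lt hl₀ (by omega)
  refine ⟨l, x', hxU, hl, hx', hlm, hxm, ?_, by omega⟩
  by_contra hn
  have hle := hxm x hl
  have hxx : x = x' := h.inj_fst (by omega)
  subst hxx
  have hgx : ∀ a, g a = g x → f a = f x := fun a e => by rw [h.inj_snd e]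
  have hgl : ∀ a, g a = g l → f a = f l := fun a e => by rw [h.inj_snd e]
  have hfx : ∀ a, f a = f x → g a = g x := fun a e => by rw [h.inj_fst e]
  have hfl : ∀ a, f a = f l → g a = g l := fun a e => by rw [h.inj_fst e]
  -- If the zigzag stalls at `x`, extremality of both `l` and `x` makes the upper elements up to `x`
  -- and the lower elements up to `l` an initial segment of both orders. This is a module containing
  -- `x` and `l` but not `y`.
  have hout : ∀ b, b ∉ {z | (z ∈ invTops f g ∧ f z ≤ f x) ∨ (z ∈ invTops g f ∧ g z ≤ g l)} →
      f x < f b ∧ f l < f b ∧ g x < g b ∧ g l < g b := by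
    intro b hb
    rcases hc b with hb' | hb'
    · have q : f x < f b := by
        by_contra q
        exact hb (.inl ⟨hb', by omega⟩)
      have := h.snd_lt hb' q
      have := hxm b
      have := hfl b
      omega
    · have q : g l < g b := by
        by_contra q
        exact hb (.inr ⟨hb', by omega⟩)
      have := h.swap.snd_lt hb' q
      have := hlm b
      have := hgx b
      omega
  rcases h.initial (S := {z | (z ∈ invTops f g ∧ f z ≤ f x) ∨ (z ∈ invTops g f ∧ g z ≤ g l)})
    (by
      rintro a (⟨ha, ha'⟩ | ⟨ha, ha'⟩) b hb
      · have hb := hout b hb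
        have := h.swap.snd_lt_of_lower (x := x) (y := a) hx
        have := hfx a
        omega
      · have hb := hout b hb
        have := h.snd_lt_of_lower (x := l) (y := a) hlL
        have := hgl a
        omega) with s | s
  · have := s (.inl ⟨hx, le_rfl⟩) (.inr ⟨hlL, le_rfl⟩)
    subst this; omega
  · have : y ∈ {z | (z ∈ invTops f g ∧ f z ≤ f x) ∨ (z ∈ invTops g f ∧ g z ≤ g l)} := by
      rw [s]; trivial
    rcases this with q | q
    · omega
    · exact h.disjoint hy q.1

end PrimePair

theorem SegmentEmbeds.mono {V : Type u} {f g : V → ℕ} {r s : ℕ → ℕ → Prop} {m n : ℕ}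
    (h : SegmentEmbeds r s n f g) (hmn : m ≤ n) : SegmentEmbeds r s m f g := by
  obtain ⟨e, he⟩ := h
  exact ⟨e, fun i hi j hj => he i (hi.trans_le hmn) j (hj.trans_le hmn)⟩

theorem sigma_two_mul_add_one (a : ℕ) : Bichain.sigma (2 * a + 1) = 2 * a + 3 := by
  rcases a with _ | a
  · rfl
  · have : 2 * (a + 1) + 1 = (2 * a + 1) + 2 := by ring
    rw [this, Bichain.sigma, if_neg (by grind)]
    ring

theorem sigma_two_mul_add_two (a : ℕ) : Bichain.sigma (2 * a + 2) = 2 * a := by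
  simp [Bichain.sigma]

namespace PrimePair

variable {V : Type u} {f g : V → ℕ}

/-- Consecutive terms of `x 0, l 0, x 1, l 1, …` are inverted; extremality forbids all other
inversions. Hence the first order reads `x 0, x 1, l 0, x 2, l 1, …` and the second `l 0, x 0, l 1,
x 1, …`. -/
theorem segment_of_path (h : PrimePair f g) {N : ℕ} {x l : ℕ → V}
    (hx : ∀ j < N, x j ∈ invTops f g)
    (h₁ : ∀ j < N, f (x j) < f (l j) ∧ g (l j) < g (x j))
    (h₂ : ∀ j < N, f (x (j + 1)) < f (l j) ∧ g (l j) < g (x (j + 1)))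
    (hlm : ∀ j < N, ∀ m, f (x j) < f m ∧ g m < g (x j) → g m ≤ g (l j))
    (hxm : ∀ j < N, ∀ z, f z < f (l j) ∧ g (l j) < g z → f z ≤ f (x (j + 1)))
    (hlt : ∀ j < N, f (x j) < f (x (j + 1))) :
    SegmentEmbeds (· ≤ ·) Bichain.leOmega N f g := by
  have hl : ∀ j < N, l j ∈ invTops g f := fun j hj => ⟨x j, (h₁ j hj).2, (h₁ j hj).1⟩
  have fx : ∀ b ≤ N, ∀ a < b, f (x a) < f (x b) := by
    intro b
    induction b with
    | zero => intro _ a ha; omega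
    | succ b ih =>
      intro hb a ha
      have := hlt b (by omega)
      rcases eq_or_lt_of_le (show a ≤ b by omega) with rfl | e
      · exact this
      · exact (ih (by omega) a e).trans this
  have fx' : ∀ b ≤ N, ∀ a ≤ b, f (x a) ≤ f (x b) := fun b hb a ha => by
    rcases eq_or_lt_of_le ha with rfl | e
    · exact le_rfl
    · exact (fx b hb a e).le
  have gx : ∀ b ≤ N, ∀ a < b, g (x a) < g (x b) := fun b hb a ha => by
    refine h.snd_lt ?_ (fx b hb a ha)
    rcases b with _ | b
    · omega
    · exact ⟨l b, h₂ b (by omega)⟩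
  have gx' : ∀ b ≤ N, ∀ a ≤ b, g (x a) ≤ g (x b) := fun b hb a ha => by
    rcases eq_or_lt_of_le ha with rfl | e
    · exact le_rfl
    · exact (gx b hb a e).le
  have hne : ∀ a < N, ∀ b < N, f (x a) ≠ f (l b) ∧ g (x a) ≠ g (l b) := fun a ha b hb =>
    ⟨fun e => h.disjoint (hx a ha) (h.inj_fst e ▸ hl b hb),
      fun e => h.disjoint (hx a ha) (h.inj_snd e ▸ hl b hb)⟩
  have flx : ∀ a ≤ N, ∀ b, b + 2 ≤ a → f (l b) ≤ f (x a) := by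
    intro a ha b hab
    by_contra hn
    have := hxm b (by omega) (x a) ⟨by omega,
      (h₁ b (by omega)).2.trans (gx a ha b (by omega))⟩
    have := fx a ha (b + 1) (by omega)
    omega
  have fl1 : ∀ b, b + 1 < N → f (l b) < f (l (b + 1)) := fun b hb =>
    (flx (b + 2) hb b le_rfl).trans_lt (h₂ (b + 1) hb).1
  have fl : ∀ b < N, ∀ a < b, f (l a) < f (l b) := by
    intro b
    induction b with
    | zero => intro _ a ha; omega
    | succ b ih =>
      intro hb a ha
      have := fl1 b (by omega)
      rcases eq_or_lt_of_le (show a ≤ b by omega) with rfl | e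
      · exact this
      · exact (ih (by omega) a e).trans this
  have gl : ∀ b < N, ∀ a < b, g (l a) < g (l b) := fun b hb a ha =>
    h.snd_lt_of_lower (hl a (by omega)) (fl b hb a ha)
  have fxl : ∀ a < N, ∀ b < N, a ≤ b + 1 → f (x a) < f (l b) := fun a ha b hb hab =>
    (fx' (b + 1) hb a hab).trans_lt (h₂ b hb).1
  have glx : ∀ a < N, ∀ b < N, b ≤ a → g (l b) < g (x a) := fun a ha b hb hab =>
    (h₁ b hb).2.trans_le (gx' a ha.le b hab)
  have gxl : ∀ a < N, ∀ b < N, a < b → g (x a) < g (l b) := by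
    intro a ha b hb hab
    by_contra hn
    have := (hne a ha b hb).2
    have := hlm a ha (l b) ⟨fxl a ha b hb (by omega), by omega⟩
    have := gl b hb a hab
    omega
  have flx' : ∀ a < N, ∀ b < N, b + 2 ≤ a → f (l b) < f (x a) := fun a ha b hb hab =>
    lt_of_le_of_ne (flx a ha.le b hab) (hne a ha b hb).1.symm
  -- This enumerates the zigzag in the first order; `sigma` then gives the positions `2 * a` for `l
  -- a` and `2 * a + 1` for `x a` in the second.
  let e : ℕ → V := fun i => if i = 0 then x 0 else if Odd i then x (i / 2 + 1) else l (i / 2 - 1)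
  have e0 : e 0 = x 0 := rfl
  have e1 : ∀ a, e (2 * a + 1) = x (a + 1) := fun a => by
    have h1 : (2 * a + 1) / 2 = a := by omega
    simp [e, h1]
  have e2 : ∀ a, e (2 * a + 2) = l a := fun a => by
    have h1 : (2 * a + 2) / 2 - 1 = a := by omega
    have h2 : ¬ Odd (2 * a + 2) := by grind
    simp only [e, h1, h2, if_false]
    simp
  have hcase : ∀ i, i = 0 ∨ ∃ a, i = 2 * a + 1 ∨ i = 2 * a + 2 := by
    intro i
    rcases i with _ | i
    · exact .inl rfl
    · obtain ⟨a, ha⟩ := Nat.even_or_odd' i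
      exact .inr ⟨a, by omega⟩
  have s0 : Bichain.sigma 0 = 1 := rfl
  refine ⟨e, fun i hi j hj hij => ?_⟩
  unfold Bichain.leOmega
  rcases hcase i with rfl | ⟨a, rfl | rfl⟩ <;> rcases hcase j with rfl | ⟨b, rfl | rfl⟩ <;>
    simp only [e0, e1, e2, s0, sigma_two_mul_add_one, sigma_two_mul_add_two]
  · omega
  · exact ⟨fun _ => fx _ (by omega) _ (by omega), fun _ => gx _ (by omega) _ (by omega)⟩
  · exact ⟨fun _ => fxl _ (by omega) _ (by omega) (by omega),
      fun _ => gxl _ (by omega) _ (by omega) (by omega)⟩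
  · exact ⟨fun _ => by omega, fun _ => by omega⟩
  · exact ⟨fun _ => fx _ (by omega) _ (by omega), fun _ => gx _ (by omega) _ (by omega)⟩
  · exact ⟨fun _ => fxl _ (by omega) _ (by omega) (by omega),
      fun _ => gxl _ (by omega) _ (by omega) (by omega)⟩
  · exact ⟨fun _ => by omega, fun _ => glx _ (by omega) _ (by omega) (by omega)⟩
  · exact ⟨fun _ => flx' _ (by omega) _ (by omega) (by omega),
      fun _ => glx _ (by omega) _ (by omega) (by omega)⟩
  · exact ⟨fun _ => fl _ (by omega) _ (by omega), fun _ => gl _ (by omega) _ (by omega)⟩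

/-- Iterating `step` from `u 0` never gets stuck, because each step passes at most `d` terms of `u`
and a linking lower element is always available. -/
theorem segment_of_separated [Finite V] (h : PrimePair f g)
    (hc : ∀ x, x ∈ invTops f g ∨ x ∈ invTops g f) {N d : ℕ} {u : ℕ → V}
    (hu : ∀ i ≤ d * N, u i ∈ invTops f g)
    (hsep : ∀ i, i + d ≤ d * N → ∃ l ∈ invTops g f, g (u i) < g l ∧ f l < f (u (i + d))) :
    SegmentEmbeds (· ≤ ·) Bichain.leOmega N f g := by
  -- The successor is chosen once for each `x`; its bound holds for every admissible `y`, `l₀`, so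
  -- the witnesses may change along the iteration.
  have hstep : ∀ x, ∃ l x', (∃ y l₀, x ∈ invTops f g ∧ y ∈ invTops f g ∧ l₀ ∈ invTops g f ∧
      g x < g l₀ ∧ f l₀ < f y) → x' ∈ invTops f g ∧ (f x < f l ∧ g l < g x) ∧
      (f x' < f l ∧ g l < g x') ∧ (∀ m, f x < f m ∧ g m < g x → g m ≤ g l) ∧
      (∀ z, f z < f l ∧ g l < g z → f z ≤ f x') ∧ f x < f x' ∧
      ∀ y l₀, y ∈ invTops f g → l₀ ∈ invTops g f → g x < g l₀ → f l₀ < f y → f x' < f y := by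
    intro x
    by_cases hx : ∃ y l₀, x ∈ invTops f g ∧ y ∈ invTops f g ∧ l₀ ∈ invTops g f ∧
      g x < g l₀ ∧ f l₀ < f y
    · obtain ⟨y, l₀, hx, hy, hl₀, h₁, h₂⟩ := hx
      obtain ⟨l, x', p₁, p₂, p₃, p₄, p₅, p₆, p₇⟩ := h.step hc hx hy hl₀ h₁ h₂
      refine ⟨l, x', fun _ => ⟨p₁, p₂, p₃, p₄, p₅, p₆, fun z l₁ _ hl₁ h₃ h₄ => ?_⟩⟩
      have : f l < f l₁ := h.swap.snd_lt hl₁ (by omega)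
      omega
    · exact ⟨x, x, fun q => absurd q hx⟩
  choose l nx hnx using hstep
  let X : ℕ → V := fun j => nx^[j] (u 0)
  have X1 : ∀ j, X (j + 1) = nx (X j) := fun j => Function.iterate_succ_apply' _ _ _
  -- Since `X j` has not passed `u (d * j)`, the lower element linking `u (d * j)` to `u (d * j +
  -- d)` also bounds the next step from `X j`.
  have key : ∀ j, d * j ≤ d * N → X j ∈ invTops f g ∧ f (X j) ≤ f (u (d * j)) := by
    intro j
    induction j with
    | zero => exact fun _ => ⟨hu 0 (by omega), le_rfl⟩
    | succ j ih =>
      intro hj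
      have hd : d * (j + 1) = d * j + d := by ring
      obtain ⟨hX, hle⟩ := ih (by omega)
      obtain ⟨l₀, hl₀, h₁, h₂⟩ := hsep (d * j) (by omega)
      have hg : g (X j) < g l₀ := by
        rcases eq_or_lt_of_le hle with e | e
        · rwa [h.inj_fst e]
        · exact (h.snd_lt (hu _ (by omega)) e).trans h₁
      have hy := hu (d * j + d) (by omega)
      have := hnx (X j) ⟨_, l₀, hX, hy, hl₀, hg, h₂⟩
      rw [X1, hd]
      exact ⟨this.1, (this.2.2.2.2.2.2 _ _ hy hl₀ hg h₂).le⟩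
  have pre : ∀ j < N, ∃ y l₀, X j ∈ invTops f g ∧ y ∈ invTops f g ∧ l₀ ∈ invTops g f ∧
      g (X j) < g l₀ ∧ f l₀ < f y := fun j hj => by
    have hd : d * (j + 1) = d * j + d := by ring
    have hN : d * (j + 1) ≤ d * N := Nat.mul_le_mul_left _ hj
    obtain ⟨hX, hle⟩ := key j (by omega)
    obtain ⟨l₀, hl₀, h₁, h₂⟩ := hsep (d * j) (by omega)
    have hg : g (X j) < g l₀ := by
      rcases eq_or_lt_of_le hle with e | e
      · rwa [h.inj_fst e]
      · exact (h.snd_lt (hu _ (by omega)) e).trans h₁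
    exact ⟨_, l₀, hX, hu (d * j + d) (by omega), hl₀, hg, h₂⟩
  have key' := fun j hj => hnx (X j) (pre j hj)
  refine h.segment_of_path (x := X) (l := l ∘ X) (fun j hj => (pre j hj).choose_spec.choose_spec.1)
    (fun j hj => (key' j hj).2.1) (fun j hj => ?_) (fun j hj => (key' j hj).2.2.2.1)
    (fun j hj => ?_) (fun j hj => ?_)
  · rw [X1]; exact (key' j hj).2.2.1
  · rw [X1]; exact (key' j hj).2.2.2.2.1
  · rw [X1]; exact (key' j hj).2.2.2.2.2.1

/-! ### Long segments in large prime bichains -/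

/-- Two lower elements are separated by an upper one in some order. So a lower element is determined
by how many upper elements precede it in each order, which leaves at most `m * m` lower elements. -/
theorem card_lt_of_upper_lt [Finite V] (h : PrimePair f g)
    (hc : ∀ x, x ∈ invTops f g ∨ x ∈ invTops g f) {m : ℕ}
    (hm : (invTops f g).ncard < m) : Nat.card V < m + m * m := by
  classical
  have := Fintype.ofFinite V
  let cnt : (V → ℕ) → V → ℕ := fun p l => {x ∈ invTops f g | p x < p l}.ncard
  have hcnt : ∀ p l, cnt p l < m := fun p l =>
    (Set.ncard_le_ncard (fun x hx => hx.1) (Set.toFinite _)).trans_lt hm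
  have hlt : ∀ p : V → ℕ, ∀ a b x, x ∈ invTops f g → p a < p x → p x < p b →
      cnt p a < cnt p b := fun p a b x hx h₁ h₂ => by
    refine Set.ncard_lt_ncard ⟨fun y hy => ⟨hy.1, hy.2.trans (h₁.trans h₂)⟩, fun q => ?_⟩
      (Set.toFinite _)
    have : p x < p a := (q ⟨hx, h₂⟩).2
    omega
  have hL : (invTops g f).ncard ≤ m * m := by
    have e : m * m = ((Finset.range m ×ˢ Finset.range m : Finset (ℕ × ℕ)) : Set (ℕ × ℕ)).ncard := by
      rw [Set.ncard_coe_finset]; simp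
    rw [e]
    refine Set.ncard_le_ncard_of_injOn (fun l => (cnt f l, cnt g l)) (fun l _ => ?_) ?_
      (Set.toFinite _)
    · simp [hcnt]
    · have main : ∀ a ∈ invTops g f, ∀ b ∈ invTops g f, g a < g b →
          cnt f a = cnt f b → cnt g a = cnt g b → False := by
        intro a ha b hb hab e₁ e₂
        obtain ⟨x, hx, ⟨h₁, h₂⟩ | ⟨h₁, h₂⟩⟩ :=
          h.swap.separate (fun x => (hc x).symm) ha hb hab
        · have := hlt g a b x hx h₁ h₂; omega
        · have := hlt f a b x hx h₁ h₂; omega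
      intro a ha b hb hab
      simp only [Prod.mk.injEq] at hab
      rcases lt_trichotomy (g a) (g b) with q | q | q
      · exact (main a ha b hb q hab.1 hab.2).elim
      · exact h.inj_snd q
      · exact (main b hb a ha q hab.1.symm hab.2.symm).elim
  have hU : (Set.univ : Set V) ⊆ invTops f g ∪ invTops g f := fun x _ => hc x
  have h₁ := Set.ncard_le_ncard hU (Set.toFinite _)
  have h₂ := Set.ncard_union_le (invTops f g) (invTops g f)
  rw [Set.ncard_univ] at h₁
  omega

/-- Large prime bichains of width two contain a long segment of `B₁`, its transpose, or `B₂`. -/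
theorem exists_segment [Finite V] (h : PrimePair f g) (n : ℕ)
    (hV : (2 * n * n + 3) + (2 * n * n + 3) * (2 * n * n + 3) ≤ Nat.card V) :
    SegmentEmbeds (· ≤ ·) Bichain.leOmegaOmega n f g ∨
      SegmentEmbeds Bichain.leOmegaOmega (· ≤ ·) n f g ∨
      SegmentEmbeds (· ≤ ·) Bichain.leOmega n f g := by
  classical
  have := Fintype.ofFinite V
  have hc := h.cover (by omega)
  have hU : 2 * n * n + 3 ≤ (invTops f g).ncard := by
    by_contra hn
    have := h.card_lt_of_upper_lt hc (not_le.1 hn)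
    omega
  rw [Set.ncard_eq_toFinset_card'] at hU
  have : Nonempty V := by
    have : 0 < Nat.card V := by omega
    exact (Nat.card_pos_iff.1 this).1
  obtain ⟨u, hu, hmono⟩ := exists_increasing_of_le_card h.inj_fst _ hU
  simp only [Set.mem_toFinset] at hu
  -- A window of `2 * n` gaps suffices for the pigeonhole with `k = n`, and `n` consecutive windows
  -- suffice for `n` zigzag steps.
  by_cases hw : ∃ i, i + 2 * n ≤ 2 * n * n ∧
      ∀ l ∈ invTops g f, ¬ (g (u i) < g l ∧ f l < f (u (i + 2 * n)))
  · obtain ⟨i, hi, hl⟩ := hw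
    rcases h.segment_of_window hc (x := fun j => u (i + j)) (k := n)
      (fun j hj => hu _ (by omega)) (fun a b hab hb => hmono _ _ (by omega) (by omega)) hl
      with q | q
    · exact .inl (q.mono (by omega))
    · exact .inr (.inl (q.mono (by omega)))
  · push Not at hw
    exact .inr (.inr (h.segment_of_separated hc (d := 2 * n) (u := u)
      (fun i hi => hu i (by omega)) hw))

end PrimePair

/-! ### From bichains to rank functions and ages -/

namespace Bichain

theorem exists_rank {V : Type u} [Finite V] {r : V → V → Prop} (hr : IsLinearOrder V r) :
    ∃ f : V → ℕ, Function.Injective f ∧ ∀ x y, r x y ↔ f x ≤ f y := by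
  have hmono : ∀ x y, r x y → {z | r z x}.ncard ≤ {z | r z y}.ncard := fun x y h =>
    Set.ncard_le_ncard (fun z hz => hr.trans _ _ _ hz h) (Set.toFinite _)
  have hiff : ∀ x y, r x y ↔ {z | r z x}.ncard ≤ {z | r z y}.ncard := by
    refine fun x y => ⟨hmono x y, fun h => ?_⟩
    have hyx : r x y ∨ r y x := hr.total x y
    rcases hyx with q | q
    · exact q
    · have hsub : {z | r z y} ⊆ {z | r z x} := fun z hz => hr.trans _ _ _ hz q
      have he := Set.eq_of_subset_of_ncard_le hsub h (Set.toFinite _)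
      have : x ∈ {z | r z y} := by rw [he]; exact hr.refl x
      exact this
  refine ⟨fun x => {z | r z x}.ncard, fun x y hxy => ?_, hiff⟩
  exact hr.antisymm _ _ ((hiff _ _).2 (le_of_eq hxy)) ((hiff _ _).2 (ge_of_eq hxy))

theorem exists_primePair (B : Bichain.{u}) [Finite B.carrier] (hB : B.IsPrime)
    (hw : WidthAtMostTwo B.interOrder) :
    ∃ f g : B.carrier → ℕ, PrimePair f g ∧ (∀ x y, B.le₁ x y ↔ f x ≤ f y) ∧
      ∀ x y, B.le₂ x y ↔ g x ≤ g y := by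
  obtain ⟨f, hf, hf'⟩ := exists_rank B.linear₁
  obtain ⟨g, hg, hg'⟩ := exists_rank B.linear₂
  refine ⟨f, g, ⟨hf, hg, ?_, ?_⟩, hf', hg'⟩
  · intro x y z h₁ h₂ h₃ h₄
    have hxy : x ≠ y := by rintro rfl; omega
    have hxz : x ≠ z := by rintro rfl; omega
    have hyz : y ≠ z := by rintro rfl; omega
    have := hw {x, y, z} (by
      intro a ha b hb _ hab
      obtain ⟨p, q⟩ : B.le₁ a b ∧ B.le₂ a b := hab
      rw [hf'] at p
      rw [hg'] at q
      simp only [Set.mem_insert_iff, Set.mem_singleton_iff] at ha hb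
      rcases ha with rfl | rfl | rfl <;> rcases hb with rfl | rfl | rfl <;>
        first | omega | contradiction)
    rw [Set.encard_eq_three.2 ⟨x, y, z, hxy, hxz, hyz, rfl⟩] at this
    exact absurd this (by decide)
  · intro M hM
    rcases hB M (by
      intro a ha a' ha' x hx
      have h₁ := hM a ha a' ha' x hx
      have h₂ := hM a' ha' a ha x hx
      have n₁ : f x ≠ f a := fun e => hx (hf e ▸ ha)
      have n₂ : f x ≠ f a' := fun e => hx (hf e ▸ ha')
      have n₃ : g x ≠ g a := fun e => hx (hg e ▸ ha)
      have n₄ : g x ≠ g a' := fun e => hx (hg e ▸ ha')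
      -- As `x` lies outside `M`, its ranks differ from those of `a` and `a'`, so weak and strict
      -- comparisons agree. Exchanging `a` and `a'` gives the reverse direction.
      simp only [hf', hg']
      omega) with rfl | ⟨a, rfl⟩ | rfl
    · exact .inl Set.subsingleton_empty
    · exact .inl Set.subsingleton_singleton
    · exact .inr rfl

theorem embeds_of_monotone {A : Bichain.{u}} {B : Bichain.{v}} (f : A.carrier → B.carrier)
    (hf : Function.Injective f) (h₁ : ∀ x y, A.le₁ x y → B.le₁ (f x) (f y))
    (h₂ : ∀ x y, A.le₂ x y → B.le₂ (f x) (f y)) : A.Embeds B := by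
  refine ⟨f, hf, fun x y => ⟨fun h => ?_, h₁ x y⟩, fun x y => ⟨fun h => ?_, h₂ x y⟩⟩
  · rcases (A.linear₁.total x y : A.le₁ x y ∨ A.le₁ y x) with q | q
    · exact q
    · rw [hf (B.linear₁.antisymm _ _ h (h₁ _ _ q))]; exact A.linear₁.refl y
  · rcases (A.linear₂.total x y : A.le₂ x y ∨ A.le₂ y x) with q | q
    · exact q
    · rw [hf (B.linear₂.antisymm _ _ h (h₂ _ _ q))]; exact A.linear₂.refl y

theorem Embeds.trans {A : Bichain.{u}} {B : Bichain.{v}} {C : Bichain.{w}} (h : A.Embeds B)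
    (h' : B.Embeds C) : A.Embeds C := by
  obtain ⟨f, hf, h₁, h₂⟩ := h
  obtain ⟨g, hg, h₁', h₂'⟩ := h'
  exact ⟨g ∘ f, hg.comp hf, fun x y => (h₁' _ _).trans (h₁ x y),
    fun x y => (h₂' _ _).trans (h₂ x y)⟩

theorem age_isHereditary (R : Bichain.{v}) : IsHereditary (age.{u} R) := by
  rintro B ⟨hB, hBR⟩ A hAB
  refine ⟨?_, hAB.trans hBR⟩
  obtain ⟨f, hf, -⟩ := hAB
  exact Finite.of_injective f hf

/-- The bichain `(ℕ, r, s)`. -/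
def ofNat (r s : ℕ → ℕ → Prop) (hr : IsLinearOrder ℕ r) (hs : IsLinearOrder ℕ s) : Bichain.{0} :=
  ⟨ℕ, r, s, hr, hs⟩

/-- A finite set of integers lies in some initial segment, so a finite bichain in the age embeds in
a segment, hence in a member of `C`. -/
theorem age_subset_of_segments {C : Set Bichain.{u}} (hC : IsHereditary C) {r s : ℕ → ℕ → Prop}
    (hr : IsLinearOrder ℕ r) (hs : IsLinearOrder ℕ s)
    (h : ∀ n, ∃ B ∈ C, ∃ f g : B.carrier → ℕ, (∀ x y, B.le₁ x y ↔ f x ≤ f y) ∧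
      (∀ x y, B.le₂ x y ↔ g x ≤ g y) ∧ SegmentEmbeds r s n f g) :
    age.{u} (ofNat r s hr hs) ⊆ C := by
  rintro A ⟨hA, hE⟩
  obtain ⟨φ, hφ, h₁, h₂⟩ : ∃ φ : A.carrier → ℕ, Function.Injective φ ∧
    (∀ x y, r (φ x) (φ y) ↔ A.le₁ x y) ∧ (∀ x y, s (φ x) (φ y) ↔ A.le₂ x y) := hE
  obtain ⟨n, hn⟩ := (Set.finite_range φ).bddAbove
  obtain ⟨B, hB, f, g, hf, hg, e, he⟩ := h (n + 1)
  have hlt : ∀ x, φ x < n + 1 := fun x => Nat.lt_succ_of_le (hn ⟨x, rfl⟩)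
  have ne : ∀ x y, x ≠ y → φ x ≠ φ y := fun x y hxy => fun e => hxy (hφ e)
  refine hC B hB A (embeds_of_monotone (fun x => e (φ x)) ?_ ?_ ?_)
  · intro x y hxy
    by_contra hne
    have k₁ := (he _ (hlt x) _ (hlt y) (ne x y hne)).1
    have k₂ := (he _ (hlt y) _ (hlt x) (ne x y hne).symm).1
    simp only at hxy
    rw [hxy] at k₁ k₂
    rcases (hr.total (φ x) (φ y) : r (φ x) (φ y) ∨ r (φ y) (φ x)) with q | q
    · exact lt_irrefl _ (k₁ q)
    · exact lt_irrefl _ (k₂ q)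
  · intro x y hxy
    rw [hf]
    by_cases hne : x = y
    · rw [hne]
    · exact ((he _ (hlt x) _ (hlt y) (ne x y hne)).1 ((h₁ x y).2 hxy)).le
  · intro x y hxy
    rw [hg]
    by_cases hne : x = y
    · rw [hne]
    · exact ((he _ (hlt x) _ (hlt y) (ne x y hne)).2 ((h₂ x y).2 hxy)).le

/-! ### Infinitely many types versus unbounded size -/

theorem Iso.card_eq {A B : Bichain.{u}} (h : A.Iso B) :
    Nat.card A.carrier = Nat.card B.carrier := Nat.card_congr h.choose

/-- The number of elements of an isomorphism type. -/
noncomputable def typeCard : Quotient isoSetoid.{u} → ℕ :=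
  Quotient.lift (fun B => Nat.card B.carrier) fun _ _ h => Iso.card_eq h

theorem infinite_primeTypes {C : Set Bichain.{u}}
    (h : ∀ n, ∃ B ∈ C, B.IsPrime ∧ n ≤ Nat.card B.carrier) : (primeTypes C).Infinite := by
  intro hfin
  obtain ⟨n, hn⟩ := (hfin.image typeCard).bddAbove
  obtain ⟨B, hB, hp, hc⟩ := h (n + 1)
  have : Nat.card B.carrier ≤ n := hn ⟨_, ⟨B, hB, hp, rfl⟩, rfl⟩
  omega

theorem finite_types_of_card (k : ℕ) : {q : Quotient isoSetoid.{u} | ∃ B : Bichain.{u},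
    Finite B.carrier ∧ Nat.card B.carrier = k ∧ Quotient.mk isoSetoid B = q}.Finite := by
  classical
  let T := {p : (Fin k → Fin k → Prop) × (Fin k → Fin k → Prop) //
    IsLinearOrder (Fin k) p.1 ∧ IsLinearOrder (Fin k) p.2}
  have lift : ∀ r : Fin k → Fin k → Prop, IsLinearOrder (Fin k) r →
      IsLinearOrder (ULift.{u} (Fin k)) (fun x y => r x.down y.down) := fun r hr =>
    { refl := fun x => hr.refl _
      trans := fun x y z => hr.trans _ _ _
      antisymm := fun x y h h' => ULift.ext _ _ (hr.antisymm _ _ h h')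
      total := fun x y => hr.total _ _ }
  let F : T → Quotient isoSetoid.{u} := fun p => Quotient.mk isoSetoid
    ⟨ULift.{u} (Fin k), fun x y => p.1.1 x.down y.down, fun x y => p.1.2 x.down y.down,
      lift _ p.2.1, lift _ p.2.2⟩
  refine (Set.finite_range F).subset ?_
  rintro _ ⟨B, hB, hk, rfl⟩
  let e : B.carrier ≃ Fin k := (Finite.equivFin B.carrier).trans (finCongr hk)
  have tr : ∀ r : B.carrier → B.carrier → Prop, IsLinearOrder B.carrier r →
      IsLinearOrder (Fin k) (fun x y => r (e.symm x) (e.symm y)) := fun r hr =>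
    { refl := fun x => hr.refl _
      trans := fun x y z => hr.trans _ _ _
      antisymm := fun x y h h' => e.symm.injective (hr.antisymm _ _ h h')
      total := fun x y => hr.total _ _ }
  refine ⟨⟨(fun x y => B.le₁ (e.symm x) (e.symm y), fun x y => B.le₂ (e.symm x) (e.symm y)),
    tr _ B.linear₁, tr _ B.linear₂⟩, Quotient.sound ?_⟩
  exact ⟨Equiv.ulift.trans e.symm, fun x y => Iff.rfl, fun x y => Iff.rfl⟩

theorem exists_large_prime {C : Set Bichain.{u}} (hfin : ∀ B ∈ C, Finite B.carrier)
    (hinf : (primeTypes C).Infinite) (n : ℕ) : ∃ B ∈ C, B.IsPrime ∧ n ≤ Nat.card B.carrier := by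
  by_contra! hn
  refine hinf (((Set.finite_Iio n).biUnion fun k _ => finite_types_of_card.{u} k).subset ?_)
  rintro _ ⟨B, hB, hp, rfl⟩
  exact Set.mem_biUnion (hn B hB hp) ⟨B, hfin B hB, rfl, rfl⟩

/-! ### Prime segments of the three bichains -/

/-- The restriction of `(ℕ, r, s)` to `{0, …, n - 1}`, in any universe. -/
def segment (r s : ℕ → ℕ → Prop) (hr : IsLinearOrder ℕ r) (hs : IsLinearOrder ℕ s) (n : ℕ) :
    Bichain.{u} where
  carrier := ULift.{u} (Fin n)
  le₁ x y := r x.down y.down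
  le₂ x y := s x.down y.down
  linear₁ :=
    { refl := fun _ => hr.refl _
      trans := fun _ _ _ => hr.trans _ _ _
      antisymm := fun _ _ h h' => ULift.ext _ _ (Fin.ext (hr.antisymm _ _ h h'))
      total := fun _ _ => hr.total _ _ }
  linear₂ :=
    { refl := fun _ => hs.refl _
      trans := fun _ _ _ => hs.trans _ _ _
      antisymm := fun _ _ h h' => ULift.ext _ _ (Fin.ext (hs.antisymm _ _ h h'))
      total := fun _ _ => hs.total _ _ }

theorem segment_mem_age {r s : ℕ → ℕ → Prop} (hr : IsLinearOrder ℕ r) (hs : IsLinearOrder ℕ s)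
    (n : ℕ) : segment.{u} r s hr hs n ∈ age.{u} (ofNat r s hr hs) :=
  ⟨inferInstanceAs (Finite (ULift.{u} (Fin n))), fun x => (x.down : Fin n).val,
    fun _ _ h => ULift.ext _ _ (Fin.ext h), fun _ _ => Iff.rfl, fun _ _ => Iff.rfl⟩

/-- Primality of a segment, in terms of sets of integers closed under betweenness. -/
theorem segment_isPrime {r s : ℕ → ℕ → Prop} (hr : IsLinearOrder ℕ r) (hs : IsLinearOrder ℕ s)
    {n : ℕ} (h : ∀ P : ℕ → Prop,
      (∀ a b x, a < n → b < n → x < n → P a → P b → r a x → r x b → P x) →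
      (∀ a b x, a < n → b < n → x < n → P a → P b → s a x → s x b → P x) →
      ∀ a b, a < b → b < n → P a → P b → ∀ x < n, P x) :
    (segment.{u} r s hr hs n).IsPrime := by
  intro M hM
  by_cases hsub : M.Subsingleton
  · rcases hsub.eq_empty_or_singleton with q | q
    · exact .inl q
    · exact .inr (.inl q)
  refine .inr (.inr ?_)
  let P : ℕ → Prop := fun a => ∃ ha : a < n, (⟨⟨a, ha⟩⟩ : ULift.{u} (Fin n)) ∈ M
  have key := h P
    (by
      rintro a b x _ _ hx ⟨ha, haM⟩ ⟨hb, hbM⟩ hax hxb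
      refine ⟨hx, ?_⟩
      by_contra hxM
      have hxa : r x a := ((hM _ hbM _ haM _ hxM).1.1 hxb)
      have : a = x := hr.antisymm _ _ hax hxa
      subst this
      exact hxM haM)
    (by
      rintro a b x _ _ hx ⟨ha, haM⟩ ⟨hb, hbM⟩ hax hxb
      refine ⟨hx, ?_⟩
      by_contra hxM
      have hxa : s x a := ((hM _ hbM _ haM _ hxM).2.1 hxb)
      have : a = x := hs.antisymm _ _ hax hxa
      subst this
      exact hxM haM)
  rw [Set.not_subsingleton_iff] at hsub
  obtain ⟨⟨⟨a, ha⟩⟩, haM, ⟨⟨b, hb⟩⟩, hbM, hab⟩ := hsub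
  have hab' : a ≠ b := by rintro rfl; exact hab rfl
  refine Set.eq_univ_of_forall ?_
  rintro ⟨⟨x, hx⟩⟩
  rcases lt_or_gt_of_ne hab' with q | q
  · exact (key a b q hb ⟨ha, haM⟩ ⟨hb, hbM⟩ x hx).2
  · exact (key b a q ha ⟨hb, hbM⟩ ⟨ha, haM⟩ x hx).2

/-- A closed set with two elements contains consecutive integers, hence both parities. In the second
order `2 * n - 1` (the last odd) and `0` (the first even) lie between them, and these span
everything in the first. With odd length the last integer would be last in both orders, and
primality would fail. -/
theorem closed_eq_all_of_leOmegaOmega {n : ℕ} (P : ℕ → Prop)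
    (h₁ : ∀ a b x, a < 2 * n → b < 2 * n → x < 2 * n → P a → P b → a ≤ x → x ≤ b → P x)
    (h₂ : ∀ a b x, a < 2 * n → b < 2 * n → x < 2 * n → P a → P b → leOmegaOmega a x →
      leOmegaOmega x b → P x)
    (a b : ℕ) (hab : a < b) (hb : b < 2 * n) (ha : P a) (hPb : P b) (x : ℕ) (hx : x < 2 * n) :
    P x := by
  have ha' : P (a + 1) := h₁ a b _ (by omega) hb (by omega) ha hPb (by omega) (by omega)
  obtain ⟨c, d, hc, hd, hPc, hPd, hco, hde⟩ :
      ∃ c d, c < 2 * n ∧ d < 2 * n ∧ P c ∧ P d ∧ Odd c ∧ Even d := by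
    rcases Nat.even_or_odd a with q | q
    · exact ⟨a + 1, a, by omega, by omega, ha', ha, by grind, q⟩
    · exact ⟨a, a + 1, by omega, by omega, ha, ha', q, by grind⟩
  have p₀ : P 0 := h₂ c d 0 hc hd (by omega) hPc hPd (by unfold leOmegaOmega; grind)
    (by unfold leOmegaOmega; grind)
  have p₁ : P (2 * n - 1) := h₂ c d (2 * n - 1) hc hd (by omega) hPc hPd
    (by unfold leOmegaOmega; grind) (by unfold leOmegaOmega; grind)
  exact h₁ 0 (2 * n - 1) x (by omega) (by omega) hx p₀ p₁ (by omega) (by omega)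

/-- A pair `2 * i + 1`, `2 * i + 2` spreads to the neighbouring pairs in both directions, because
their `sigma` values interleave. The length is odd because an odd last integer would be last in both
orders; for `m = 1` the set `{0, 1}` is a module. -/
theorem closed_eq_all_of_leOmega {m : ℕ} (hm : 2 ≤ m) (P : ℕ → Prop)
    (h₁ : ∀ a b x, a < 2 * m + 1 → b < 2 * m + 1 → x < 2 * m + 1 → P a → P b →
      a ≤ x → x ≤ b → P x)
    (h₂ : ∀ a b x, a < 2 * m + 1 → b < 2 * m + 1 → x < 2 * m + 1 → P a → P b → leOmega a x →
      leOmega x b → P x)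
    (a b : ℕ) (hab : a < b) (hb : b < 2 * m + 1) (ha : P a) (hPb : P b) (x : ℕ)
    (hx : x < 2 * m + 1) : P x := by
  have s0 : sigma 0 = 1 := rfl
  have s1 := sigma_two_mul_add_one
  have s2 := sigma_two_mul_add_two
  unfold leOmega at h₂
  have ha' : P (a + 1) := h₁ a b _ (by omega) hb (by omega) ha hPb (by omega) (by omega)
  have up : ∀ i, i < m → P (2 * i + 1) → P (2 * i + 2) → ∀ j, i ≤ j → j < m →
      P (2 * j + 1) ∧ P (2 * j + 2) := by
    intro i hi p₁ p₂ j hij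
    induction j, hij using Nat.le_induction with
    | base => exact fun _ => ⟨p₁, p₂⟩
    | succ j hij ih =>
      intro hj
      obtain ⟨q₁, q₂⟩ := ih (by omega)
      have r₂ : P (2 * (j + 1) + 2) := h₂ (2 * j + 2) (2 * j + 1) _ (by omega) (by omega)
        (by omega) q₂ q₁ (by rw [s2, s2]; omega) (by rw [s2, s1]; omega)
      exact ⟨h₁ _ _ _ (by omega) (by omega) (by omega) q₂ r₂ (by omega) (by omega), r₂⟩
  have down : ∀ i, i < m → P (2 * i + 1) → P (2 * i + 2) → P 1 ∧ P 2 := by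
    intro i
    induction i with
    | zero => exact fun _ p q => ⟨p, q⟩
    | succ i ih =>
      intro hi p₁ p₂
      have r₁ : P (2 * i + 1) := h₂ (2 * (i + 1) + 2) (2 * (i + 1) + 1) _ (by omega) (by omega)
        (by omega) p₂ p₁ (by rw [s2, s1]; omega) (by rw [s1, s1]; omega)
      exact ih (by omega) r₁ (h₁ _ _ _ (by omega) (by omega) (by omega) r₁ p₁ (by omega) (by omega))
  have fin : ∀ i, i < m → P (2 * i + 1) → P (2 * i + 2) → P x := by
    intro i hi p₁ p₂
    obtain ⟨q₁, q₂⟩ := down i hi p₁ p₂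
    have q₀ : P 0 := h₂ 2 1 0 (by omega) (by omega) (by omega) q₂ q₁
      (by rw [s2 0, s0]; omega) (by rw [s1 0, s0]; omega)
    obtain ⟨-, r⟩ := up 0 (by omega) q₁ q₂ (m - 1) (by omega) (by omega)
    exact h₁ 0 _ x (by omega) (by omega) hx q₀ r (by omega) (by omega)
  -- It remains to reach a pair `2 * i + 1`, `2 * i + 2` from consecutive `a`, `a + 1`; the pairs
  -- starting at `0` or at another even integer need the second order first.
  rcases a with _ | a
  · have p₄ : P 4 := h₂ 0 1 4 (by omega) (by omega) (by omega) ha ha'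
      (by rw [s2 1, s0]; omega) (by rw [s2 1, s1 0]; omega)
    have p₂ : P 2 := h₁ 1 4 2 (by omega) (by omega) (by omega) ha' p₄ (by omega) (by omega)
    exact fin 0 (by omega) ha' p₂
  · obtain ⟨i, rfl | rfl⟩ := Nat.even_or_odd' a
    · exact fin i (by omega) ha ha'
    · have p₁ : P (2 * i + 1) := h₂ (2 * i + 2) (2 * (i + 1) + 1) _ (by omega) (by omega)
        (by omega) ha ha' (by rw [s2, s1]; omega) (by rw [s1, s1]; omega)
      exact fin i (by omega) p₁ ha

theorem card_segment {r s : ℕ → ℕ → Prop} (hr : IsLinearOrder ℕ r) (hs : IsLinearOrder ℕ s)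
    (n : ℕ) : Nat.card (segment.{u} r s hr hs n).carrier = n := by
  change Nat.card (ULift.{u} (Fin n)) = n
  simp

theorem infinite_primeTypes_age_B₁ : (primeTypes (age.{u} B₁)).Infinite :=
  infinite_primeTypes fun n => ⟨_,
    segment_mem_age isLinearOrder_natLe isLinearOrder_leOmegaOmega (2 * n),
    segment_isPrime isLinearOrder_natLe isLinearOrder_leOmegaOmega closed_eq_all_of_leOmegaOmega,
    by rw [card_segment]; omega⟩

theorem infinite_primeTypes_age_B₁_transpose : (primeTypes (age.{u} B₁.transpose)).Infinite :=
  infinite_primeTypes fun n => ⟨_,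
    segment_mem_age isLinearOrder_leOmegaOmega isLinearOrder_natLe (2 * n),
    segment_isPrime isLinearOrder_leOmegaOmega isLinearOrder_natLe
      fun P h₁ h₂ => closed_eq_all_of_leOmegaOmega P h₂ h₁,
    by rw [card_segment]; omega⟩

theorem infinite_primeTypes_age_B₂ : (primeTypes (age.{u} B₂)).Infinite :=
  infinite_primeTypes fun n => ⟨_,
    segment_mem_age isLinearOrder_natLe isLinearOrder_leOmega (2 * (n + 2) + 1),
    segment_isPrime isLinearOrder_natLe isLinearOrder_leOmega
      (closed_eq_all_of_leOmega (by omega)),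
    by rw [card_segment]; omega⟩

/-! ### Conclusion by minimality -/

theorem IsMinimalPrime.eq_age {C : Set Bichain.{u}} (hC : IsMinimalPrime C) {R : Bichain.{v}}
    (hR : (primeTypes (age.{u} R)).Infinite) (h : age.{u} R ⊆ C) : C = age.{u} R := by
  by_contra hne
  exact hR (hC.minimal _ (age_isHereditary R) (h.ssubset_of_ne (Ne.symm hne)))

end Bichain

theorem mainTheorem7 (C : Set Bichain.{u}) (hC : Bichain.IsMinimalPrime C)
    (hwidth : ∀ B ∈ C, WidthAtMostTwo B.interOrder) :
    C = Bichain.age Bichain.B₁ ∨ C = Bichain.age Bichain.B₁.transpose ∨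
      C = Bichain.age Bichain.B₂ := by
  let Q (r s : ℕ → ℕ → Prop) (n : ℕ) : Prop := ∃ B ∈ C, ∃ f g : B.carrier → ℕ,
    (∀ x y, B.le₁ x y ↔ f x ≤ f y) ∧ (∀ x y, B.le₂ x y ↔ g x ≤ g y) ∧ SegmentEmbeds r s n f g
  have hQ : ∀ r s m n, m ≤ n → Q r s n → Q r s m := fun r s m n hmn => by
    rintro ⟨B, hB, f, g, h₁, h₂, h⟩
    exact ⟨B, hB, f, g, h₁, h₂, h.mono hmn⟩
  have main : ∀ n, Q (· ≤ ·) Bichain.leOmegaOmega n ∨ Q Bichain.leOmegaOmega (· ≤ ·) n ∨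
      Q (· ≤ ·) Bichain.leOmega n := by
    intro n
    obtain ⟨B, hB, hp, hc⟩ := Bichain.exists_large_prime hC.finite hC.infinite_primes
      ((2 * n * n + 3) + (2 * n * n + 3) * (2 * n * n + 3))
    have := hC.finite B hB
    obtain ⟨f, g, h, h₁, h₂⟩ := B.exists_primePair hp (hwidth B hB)
    rcases h.exists_segment n hc with q | q | q
    · exact .inl ⟨B, hB, f, g, h₁, h₂, q⟩
    · exact .inr (.inl ⟨B, hB, f, g, h₁, h₂, q⟩)
    · exact .inr (.inr ⟨B, hB, f, g, h₁, h₂, q⟩)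
  by_cases c₁ : ∀ n, Q (· ≤ ·) Bichain.leOmegaOmega n
  · exact .inl (hC.eq_age Bichain.infinite_primeTypes_age_B₁
      (Bichain.age_subset_of_segments hC.hereditary _ _ c₁))
  by_cases c₂ : ∀ n, Q Bichain.leOmegaOmega (· ≤ ·) n
  · exact .inr (.inl (hC.eq_age Bichain.infinite_primeTypes_age_B₁_transpose
      (Bichain.age_subset_of_segments hC.hereditary _ _ c₂)))
  refine .inr (.inr (hC.eq_age Bichain.infinite_primeTypes_age_B₂
    (Bichain.age_subset_of_segments hC.hereditary _ _ fun n => ?_)))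
  obtain ⟨n₁, hn₁⟩ := not_forall.1 c₁
  obtain ⟨n₂, hn₂⟩ := not_forall.1 c₂
  -- At a length beyond both failures `n₁` and `n₂`, monotonicity of `Q` in the length leaves only
  -- the third case.
  rcases main (n + n₁ + n₂) with q | q | q
  · exact absurd (hQ _ _ _ _ (by omega) q) hn₁
  · exact absurd (hQ _ _ _ _ (by omega) q) hn₂
  · exact hQ _ _ _ _ (by omega) q
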